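/- Let $m\ge 0$ and $n\ge 1$ be integers. For $c\in\mathbb R^N$ write $\mathcal C(c)$ for the $N\times N$ companion matrix with ones on the superdiagonal, last row $(-c_1,\dots,-c_N)$ and all other entries zero. Let $a=(a_1,\dots,a_n)\in\mathbb R^n$ and $\Phi(a)=\mathcal C(a)$, whose characteristic polynomial is $\varsigma^n+a_n\varsigma^{n-1}+\dots+a_2\varsigma+a_1$, and suppose that all eigenvalues of $\Phi(a)$ are distinct and have zero real part. Let $v:[0,\infty)\to\mathbb R^n$ solve $\dot v=\Phi(a)v$, let $\Gamma=[1\;0\;\cdots\;0]\in\mathbb R^{1\times n}$, and suppose that $y_0=\Gamma v$ is the multi-tone signal $$y_0(t)=d_0+\sum_{k=1}^m d_k\sin(\omega_k t+\phi_k),\qquad t\ge 0,$$ where $d_0\in\mathbb R$, all amplitudes $d_k$ are nonzero, the frequencies $\omega_k\in\mathbb R$ are nonzero with pairwise distinct absolute values, $\phi_k\in\mathbb R$, and $n=2m$ if $d_0=0$, $n=2m+1$ if $d_0\ne 0$. Let $m_1,\dots,m_{2n}\in\mathbb R$ be such that $M=\mathcal C(m_1,\dots,m_{2n})\in\mathbb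 R^{2n\times 2n}$ is Hurwitz (all its eigenvalues have negative real part), and let $N=[0\;\cdots\;0\;1]^\top\in\mathbb R^{2n}$. For $\theta\in\mathbb R^{2n}$ let $\Theta(\theta)\in\mathbb R^{n\times n}$ be the Hankel matrix with entries $\Theta(\theta)_{ij}=\theta_{i+j-1}$, and for $\alpha\in\mathbb R^n$ let $$\Xi(\alpha)=\Phi(\alpha)^{2n}+\sum_{j=1}^{2n}m_j\Phi(\alpha)^{j-1}.$$ Let $k_1>0$ and consider, for $t\ge 0$, the observer $$\dot\eta=M\eta+Ny_0,\qquad \dot{\hat a}=-k_1\Theta(\eta)^\top\bigl[\Theta(\eta)\hat a+\mathrm{col}(\eta_{n+1},\dots,\eta_{2n})\bigr],\qquad \hat y=\Gamma\,\Xi(\hat a)\,\mathrm{col}(\eta_1,\dots,\eta_n),$$ with state $(\eta,\hat a)\in\mathbb R^{2n}\times\mathbb R^n$. Then for all initial values $\eta(0)\in\mathbb R^{2n}$, $\hat a(0)\in\mathbb R^n$ the observer has a solution on $[0,\infty)$, and the estimate and the reconstructed output converge globally and exponentially: there is $\lambda>0$, independent of the initial values, such that for every $R$ there is a constant $C$ such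 that every solution on $[0,\infty)$ with $\|\eta(0)\|\le R$ and $\|\hat a(0)\|\le R$ satisfies, for all $t\ge 0$, $$\|\hat a(t)-a\|\le Ce^{-\lambda t}\qquad\text{and}\qquad |\hat y(t)-y_0(t)|\le Ce^{-\lambda t}.$$ -/

import Mathlib

namespace SinusoidObserver

/-- The lower companion matrix whose superdiagonal entries are `1` and whose last row is
`(-c₁, …, -c_N)`. -/
def companion {N : ℕ} (c : Fin N → ℝ) : Matrix (Fin N) (Fin N) ℝ :=
  Matrix.of fun i j =>
    if (i : ℕ) + 1 = N then -c j else if (j : ℕ) = (i : ℕ) + 1 then 1 else 0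

/-- The row vector `Γ = (1, 0, …, 0)`. -/
def Gam (n : ℕ) : Fin n → ℝ := fun i => if (i : ℕ) = 0 then 1 else 0

/-- The column vector `N = (0, …, 0, 1)ᵀ` of length `2n`. -/
def inputVec (n : ℕ) : Fin (2 * n) → ℝ := fun i => if (i : ℕ) + 1 = 2 * n then 1 else 0

/-- A real square matrix is Hurwitz if all its complex eigenvalues have negative real part. -/
def IsHurwitz {N : ℕ} (A : Matrix (Fin N) (Fin N) ℝ) : Prop :=
  ∀ z ∈ spectrum ℂ (A.map Complex.ofReal), z.re < 0

/-- All complex eigenvalues are distinct and have zero real part. -/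
def HasDistinctImaginaryEigenvalues {n : ℕ} (A : Matrix (Fin n) (Fin n) ℝ) : Prop :=
  (A.map Complex.ofReal).charpoly.roots.Nodup ∧
    ∀ z ∈ (A.map Complex.ofReal).charpoly.roots, z.re = 0

/-- `Ξ(a) = Φ(a)^{2n} + ∑_{j=1}^{2n} m_j Φ(a)^{j-1}`, where `Φ(a) = companion a`. -/
def Xi {n : ℕ} (mc : Fin (2 * n) → ℝ) (a : Fin n → ℝ) : Matrix (Fin n) (Fin n) ℝ :=
  companion a ^ (2 * n) + ∑ j : Fin (2 * n), mc j • companion a ^ (j : ℕ)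

/-- The `n × n` real Hankel matrix of `θ ∈ ℝ^{2n}`, with entries `θ_{i+j-1}`, `1 ≤ i, j ≤ n`. -/
def Hankel {n : ℕ} (θ : Fin (2 * n) → ℝ) : Matrix (Fin n) (Fin n) ℝ :=
  Matrix.of fun i j => θ ⟨(i : ℕ) + (j : ℕ), by omega⟩

/-- `col(θ₁, …, θ_n)`. -/
def firstHalf {n : ℕ} (θ : Fin (2 * n) → ℝ) : Fin n → ℝ := fun i => θ ⟨(i : ℕ), by omega⟩

/-- `col(θ_{n+1}, …, θ_{2n})`. -/
def secondHalf {n : ℕ} (θ : Fin (2 * n) → ℝ) : Fin n → ℝ := fun i => θ ⟨n + (i : ℕ), by omega⟩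

/-- The reconstructed output `χ(η, â) = Γ Ξ(â) col(η₁, …, η_n)`. -/
def outputMap {n : ℕ} (mc η : Fin (2 * n) → ℝ) (ah : Fin n → ℝ) : ℝ :=
  Gam n ⬝ᵥ (Matrix.mulVec (Xi mc ah) (firstHalf η))

/-- `v` solves the exosystem `v' = Φ(a) v` on `[0, ∞)`. -/
def IsExosystemSolution {n : ℕ} (a : Fin n → ℝ) (v : ℝ → Fin n → ℝ) : Prop :=
  ∀ t : ℝ, 0 ≤ t → HasDerivWithinAt v (Matrix.mulVec (companion a) (v t)) (Set.Ici 0) t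

/-- `(η, â)` solves on `[0, ∞)` the observer equations
`η' = M η + N y`, `â' = -k₁ Θ(η)ᵀ (Θ(η) â + col(η_{n+1}, …, η_{2n}))`. -/
def IsObserverSolution {n : ℕ} (mc : Fin (2 * n) → ℝ) (k₁ : ℝ) (y : ℝ → ℝ)
    (η : ℝ → Fin (2 * n) → ℝ) (ah : ℝ → Fin n → ℝ) : Prop :=
  ∀ t : ℝ, 0 ≤ t →
    HasDerivWithinAt η (Matrix.mulVec (companion mc) (η t) + y t • inputVec n) (Set.Ici 0) t ∧
    HasDerivWithinAt ah
      (-(k₁ • Matrix.mulVec (Matrix.transpose (Hankel (η t)))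
          (Matrix.mulVec (Hankel (η t)) (ah t) + secondHalf (η t)))) (Set.Ici 0) t

/-- The Euclidean norm on `ℝ^N`. -/
noncomputable def euclNorm {N : ℕ} (x : Fin N → ℝ) : ℝ :=
  ‖(WithLp.toLp 2 x : EuclideanSpace ℝ (Fin N))‖

end SinusoidObserver

namespace SinusoidObserver

open Set Filter Topology NNReal Matrix

/-! The signal is a sum of `n` exponentials `c_k e^{μ_k t}` with distinct imaginary `μ_k` and `c_k ≠
0`. The exosystem forces each `μ_k` to be a zero of its characteristic polynomial `charEval a`
(`charEval_eq_zero_of_exosystem`). Since `M` is Hurwitz, `charEval mc (μ k) ≠ 0`, and the filter has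
the steady state `expJet (2 * n) μ γ` with `γ_k = c_k / charEval mc (μ k)`; the difference from it
solves `x' = M x` and decays exponentially (`exists_filter_decay`).

On the steady state the Hankel matrix factors as `Vᵀ D(t) V`, with `V` Vandermonde and `D(t)`
diagonal with entries of constant nonzero modulus, so it is bounded below uniformly in time
(`exists_le_norm_complexHankel_expJet`): excitation holds at every instant. There `a` solves the
regression equation exactly. Hence `V = ‖â - a‖²` satisfies `V' ≤ -g V` up to exponentially small
terms (`lyapunov_le`, `decay_of_deriv_le`).

Finally, `Ξ(a)` multiplies the `k`-th mode by `charEval mc (μ k)`, undoing the filter gain, so the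
output map returns `y₀` on the steady state; its local Lipschitz property transfers the decay to
`ŷ`. -/

/-! ### Global existence for Lipschitz time-dependent fields. -/

/-- Coordinatewise truncation of a vector to the sup-norm ball of radius `A`. -/
noncomputable def clamp {n : ℕ} (A : ℝ) (x : Fin n → ℝ) : Fin n → ℝ :=
  fun i => max (-A) (min A (x i))

lemma norm_clamp_le {n : ℕ} {A : ℝ} (hA : 0 ≤ A) (x : Fin n → ℝ) : ‖clamp A x‖ ≤ A := by
  refine (pi_norm_le_iff_of_nonneg hA).2 fun i => ?_
  rw [Real.norm_eq_abs, abs_le]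
  exact ⟨le_max_left _ _, max_le (by linarith) (min_le_left _ _)⟩

lemma clamp_eq_self {n : ℕ} {A : ℝ} {x : Fin n → ℝ} (hx : ‖x‖ ≤ A) : clamp A x = x := by
  funext i
  have h := abs_le.1 ((Real.norm_eq_abs (x i) ▸ norm_le_pi_norm x i).trans hx)
  simp only [clamp]
  rw [min_eq_right h.2, max_eq_right h.1]

lemma norm_clamp_le_norm {n : ℕ} {A : ℝ} (hA : 0 ≤ A) (x : Fin n → ℝ) : ‖clamp A x‖ ≤ ‖x‖ := by
  rcases le_total ‖x‖ A with h | h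
  · rw [clamp_eq_self h]
  · exact (norm_clamp_le hA x).trans h

lemma lipschitzWith_clamp {n : ℕ} (A : ℝ) : LipschitzWith 1 (clamp A : (Fin n → ℝ) → _) := by
  refine LipschitzWith.of_dist_le_mul fun x y => ?_
  rw [NNReal.coe_one, one_mul]
  refine (dist_pi_le_iff dist_nonneg).2 fun i => ?_
  have h : LipschitzWith 1 fun s : ℝ => max (-A) (min A s) :=
    (LipschitzWith.id.const_min A).const_max (-A)
  have := h.dist_le_mul (x i) (y i)
  rw [NNReal.coe_one, one_mul] at this
  exact this.trans (dist_le_pi_dist x y i)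

/-- A time-dependent vector field that is Lipschitz in the state has a solution on `[0, T]`. -/
lemma exists_solution_Icc {n : ℕ} {f : ℝ → (Fin n → ℝ) → Fin n → ℝ} {T : ℝ} (hT : 0 ≤ T)
    (hc : ∀ x, ContinuousOn (fun t => f t x) (Icc 0 T)) {K : ℝ≥0}
    (hK : ∀ t ∈ Icc 0 T, LipschitzWith K (f t)) (x₀ : Fin n → ℝ) :
    ∃ x : ℝ → Fin n → ℝ, x 0 = x₀ ∧
      ∀ t ∈ Icc 0 T, HasDerivWithinAt x (f t (x t)) (Icc 0 T) t := by
  obtain ⟨G, hG⟩ := isCompact_Icc.exists_bound_of_continuousOn (hc 0)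
  have hG0 : 0 ≤ G := (norm_nonneg _).trans (hG 0 ⟨le_rfl, hT⟩)
  -- A priori Grönwall bound for any solution. Truncating the state at `A` makes the field bounded
  -- by `L`, so Picard–Lindelöf applies on all of `[0, T]` with radius `L * T`; the solution then
  -- obeys the bound, and the truncation is inactive.
  set A := gronwallBound ‖x₀‖ K G T
  have hmono := gronwallBound_mono (norm_nonneg x₀) hG0 K.2
  have hA0 : 0 ≤ A := by
    have := hmono hT
    rw [gronwallBound_x0] at this
    exact (norm_nonneg _).trans this
  have hgrow : ∀ t ∈ Icc 0 T, ∀ x, ‖f t x‖ ≤ K * ‖x‖ + G := by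
    intro t ht x
    have h1 := (hK t ht).norm_sub_le x 0
    rw [sub_zero] at h1
    have h2 := norm_le_norm_add_norm_sub' (f t x) (f t 0)
    linarith [hG t ht]
  obtain ⟨L, hL⟩ : ∃ L : ℝ≥0, (L : ℝ) = K * A + G := CanLift.prf (K * A + G) (by positivity)
  obtain ⟨r, hr⟩ : ∃ r : ℝ≥0, (r : ℝ) = L * T := CanLift.prf (L * T) (by positivity)
  have hpl : IsPicardLindelof (fun t x => f t (clamp A x)) (⟨0, le_rfl, hT⟩ : Icc (0 : ℝ) T) x₀
      r 0 L K := by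
    refine ⟨fun t ht => ?_, fun x _ => hc _, fun t ht x _ => ?_, ?_⟩
    · have := ((hK t ht).comp (lipschitzWith_clamp A)).lipschitzOnWith (s := Metric.closedBall x₀ r)
      rw [mul_one] at this
      exact this
    · refine (hgrow t ht _).trans ?_
      have := norm_clamp_le hA0 x
      have hK0 := K.2
      rw [hL]
      gcongr
    · simp [hT, hr]
  obtain ⟨x, hx0, hx⟩ := hpl.exists_eq_forall_mem_Icc_hasDerivWithinAt₀
  refine ⟨x, hx0, fun t ht => ?_⟩
  have hb := norm_le_gronwallBound_of_norm_deriv_right_le (f := x) (δ := ‖x₀‖) (K := K) (ε := G)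
    (fun t ht => (hx t ht).continuousWithinAt)
    (fun t ht => (hx t (Ico_subset_Icc_self ht)).mono_of_mem_nhdsWithin
      (Icc_mem_nhdsGE_of_mem ht)) (by rw [← hx0])
    (fun t ht => (hgrow t (Ico_subset_Icc_self ht) _).trans (by
      have := norm_clamp_le_norm hA0 (x t)
      have hK0 := K.2
      gcongr)) t ht
  rw [sub_zero] at hb
  have := hx t ht
  rwa [clamp_eq_self (A := A) (hb.trans (hmono ht.2))] at this

/-- A time-dependent vector field that is Lipschitz in the state, uniformly on bounded time
intervals, has a solution on `[0, ∞)`. -/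
theorem exists_solution_Ici {n : ℕ} {f : ℝ → (Fin n → ℝ) → Fin n → ℝ}
    (hc : ∀ x, ContinuousOn (fun t => f t x) (Ici 0))
    (hK : ∀ T : ℝ, ∃ K : ℝ≥0, ∀ t ∈ Icc 0 T, LipschitzWith K (f t)) (x₀ : Fin n → ℝ) :
    ∃ x : ℝ → Fin n → ℝ, x 0 = x₀ ∧
      ∀ t, 0 ≤ t → HasDerivWithinAt x (f t (x t)) (Ici 0) t := by
  have hex : ∀ T : ℝ, ∃ x : ℝ → Fin n → ℝ, 0 ≤ T → x 0 = x₀ ∧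
      ∀ t ∈ Icc 0 T, HasDerivWithinAt x (f t (x t)) (Icc 0 T) t := by
    intro T
    by_cases hT : 0 ≤ T
    · obtain ⟨K, hK⟩ := hK T
      obtain ⟨x, hx⟩ := exists_solution_Icc hT (fun x => (hc x).mono Icc_subset_Ici_self) hK x₀
      exact ⟨x, fun _ => hx⟩
    · exact ⟨0, fun h => absurd h hT⟩
  choose X hX using hex
  have hright : ∀ {S T : ℝ}, 0 ≤ S → S ≤ T → ∀ t ∈ Ico 0 S,
      HasDerivWithinAt (X T) (f t (X T t)) (Ici t) t := fun hS hST t ht =>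
    ((hX _ (hS.trans hST)).2 t ⟨ht.1, ht.2.le.trans hST⟩).mono_of_mem_nhdsWithin
      (Icc_mem_nhdsGE_of_mem ⟨ht.1, ht.2.trans_le hST⟩)
  have hcont : ∀ {S T : ℝ}, 0 ≤ S → S ≤ T → ContinuousOn (X T) (Icc 0 S) := fun hS hST t ht =>
    ((hX _ (hS.trans hST)).2 t ⟨ht.1, ht.2.trans hST⟩).continuousWithinAt.mono
      (Icc_subset_Icc_right hST)
  have hmono : ∀ {S T : ℝ}, 0 ≤ S → S ≤ T → EqOn (X S) (X T) (Icc 0 S) := by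
    intro S T hS hST
    obtain ⟨K, hK⟩ := hK S
    refine ODE_solution_unique_of_mem_Icc_right (K := K) (s := fun _ => univ)
      (fun t ht => (hK t (Ico_subset_Icc_self ht)).lipschitzOnWith) (hcont hS le_rfl)
      (hright hS le_rfl) (fun _ _ => trivial) (hcont hS hST) (hright hS hST)
      (fun _ _ => trivial) ?_
    rw [(hX S hS).1, (hX T (hS.trans hST)).1]
  have heq : ∀ {S T t : ℝ}, 0 ≤ t → t ≤ S → t ≤ T → X S t = X T t := by
    intro S T t h0 hS hT
    rcases le_total S T with h | h
    · exact hmono (h0.trans hS) h ⟨h0, hS⟩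
    · exact (hmono (h0.trans hT) h ⟨h0, hT⟩).symm
  -- The horizon `t + 1` leaves room to the right of `t`, so the derivative within `Icc 0 (t + 1)`
  -- is one within `Ici 0`.
  refine ⟨fun t => X (t + 1) t, (hX _ (by norm_num)).1, fun t ht => ?_⟩
  have h1 := (hX (t + 1) (by linarith)).2 t ⟨ht, by linarith⟩
  have h2 : HasDerivWithinAt (fun t => X (t + 1) t) (f t (X (t + 1) t)) (Icc 0 (t + 1)) t :=
    h1.congr_of_mem (fun s hs => heq hs.1 (by linarith) hs.2) ⟨ht, by linarith⟩
  refine h2.mono_of_mem_nhdsWithin ?_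
  rw [← Ici_inter_Iic]
  exact inter_mem self_mem_nhdsWithin (mem_nhdsWithin_of_mem_nhds (Iic_mem_nhds (by linarith)))

/-! ### Exponential decay of Hurwitz linear systems. -/

lemma exists_mulVec_norm_le {N : ℕ} (A : Matrix (Fin N) (Fin N) ℂ) :
    ∃ K : ℝ, 0 ≤ K ∧ ∀ x : Fin N → ℂ, ‖A *ᵥ x‖ ≤ K * ‖x‖ :=
  ⟨‖LinearMap.toContinuousLinearMap (Matrix.mulVecLin A)‖, norm_nonneg _,
    fun x => (LinearMap.toContinuousLinearMap (Matrix.mulVecLin A)).le_opNorm x⟩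

lemma hasDerivWithinAt_mulVec {N : ℕ} (A : Matrix (Fin N) (Fin N) ℂ) {X : ℝ → Fin N → ℂ}
    {X' : Fin N → ℂ} {s : Set ℝ} {t : ℝ} (h : HasDerivWithinAt X X' s t) :
    HasDerivWithinAt (fun t => A *ᵥ X t) (A *ᵥ X') s t := by
  rw [hasDerivWithinAt_pi] at h ⊢
  intro i
  simp only [mulVec, dotProduct]
  exact HasDerivWithinAt.fun_sum fun j _ => (h j).const_mul _

lemma exists_neg_bound (s : Multiset ℂ) (hs : ∀ z ∈ s, z.re < 0) :
    ∃ β : ℝ, 0 < β ∧ ∀ z ∈ s, z.re < -β := by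
  induction s using Multiset.induction_on with
  | empty => exact ⟨1, one_pos, by simp⟩
  | cons z s ih =>
    obtain ⟨β, hβ, h⟩ := ih fun w hw => hs w (Multiset.mem_cons_of_mem hw)
    have hz := hs z (Multiset.mem_cons_self z s)
    refine ⟨min β (-z.re / 2), lt_min hβ (by linarith), fun w hw => ?_⟩
    rcases Multiset.mem_cons.1 hw with rfl | hw
    · linarith [min_le_right β (-w.re / 2)]
    · linarith [h w hw, min_le_left β (-z.re / 2)]

/-- A stable first-order equation driven by an exponentially decaying input has an exponentially
decaying solution. -/
lemma norm_le_of_hasDerivWithinAt_smul_add {N : ℕ} {X F : ℝ → Fin N → ℂ} {z : ℂ} {β C : ℝ}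
    (hz : z.re < -β) (hF : ∀ t, 0 ≤ t → ‖F t‖ ≤ C * Real.exp (-β * t))
    (hX : ∀ t, 0 ≤ t → HasDerivWithinAt X (z • X t + F t) (Ici 0) t) {t : ℝ} (ht : 0 ≤ t) :
    ‖X t‖ ≤ (‖X 0‖ + C / (-z.re - β)) * Real.exp (-β * t) := by
  set r := -z.re - β with hr
  have hr0 : 0 < r := by linarith
  have hC : 0 ≤ C := by simpa using (norm_nonneg _).trans (hF 0 le_rfl)
  have hexp : ∀ s : ℝ, HasDerivAt (fun s : ℝ => Complex.exp (-z * s))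
      (Complex.exp (-z * s) * -z) s := fun s => by
    have h : HasDerivAt (fun s : ℝ => -z * (s : ℂ)) (-z) s := by
      simpa using (Complex.ofRealCLM.hasDerivAt (x := s)).const_mul (-z)
    exact h.cexp
  have hn : ∀ s : ℝ, ‖Complex.exp (-z * s)‖ = Real.exp (-z.re * s) := fun s => by
    rw [Complex.norm_exp]; simp
  have hY : ∀ s : ℝ, 0 ≤ s → HasDerivWithinAt (fun s : ℝ => Complex.exp (-z * s) • X s)
      (Complex.exp (-z * s) • F s) (Ici 0) s := fun s hs => by
    refine ((hexp s).hasDerivWithinAt.smul (hX s hs)).congr_deriv ?_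
    module
  -- Multiplying by `e^{-zs}` leaves a derivative of norm at most `C e^{rs}`; the boundary function
  -- is its integral.
  have hb := image_norm_le_of_norm_deriv_right_le_deriv_boundary
    (f := fun s : ℝ => Complex.exp (-z * s) • X s) (f' := fun s => Complex.exp (-z * s) • F s)
    (a := 0) (b := t) (B := fun s => ‖X 0‖ + C / r * (Real.exp (r * s) - 1))
    (B' := fun s => C * Real.exp (r * s))
    (fun s hs => (hY s hs.1).continuousWithinAt.mono Icc_subset_Ici_self)
    (fun s hs => (hY s hs.1).mono (Ici_subset_Ici.2 hs.1)) (by simp)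
    (fun s => by
      have h := ((((hasDerivAt_id s).const_mul r).exp.sub_const 1).const_mul (C / r)).const_add ‖X 0‖
      have h2 : C / r * r = C := div_mul_cancel₀ C hr0.ne'
      refine h.congr_deriv ?_
      rw [mul_one, mul_comm (Real.exp _) r, ← mul_assoc, h2]
      rfl)
    (fun s hs => by
      rw [norm_smul, hn]
      calc Real.exp (-z.re * s) * ‖F s‖ ≤ Real.exp (-z.re * s) * (C * Real.exp (-β * s)) := by
            gcongr; exact hF s hs.1
        _ = C * Real.exp (r * s) := by
            rw [mul_left_comm, ← Real.exp_add]; congr 2; rw [hr]; ring) ⟨ht, le_rfl⟩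
  rw [norm_smul, hn] at hb
  have h1 : ‖X t‖ = Real.exp (z.re * t) * (Real.exp (-z.re * t) * ‖X t‖) := by
    rw [← mul_assoc, ← Real.exp_add]; simp
  rw [h1]
  calc Real.exp (z.re * t) * (Real.exp (-z.re * t) * ‖X t‖)
      ≤ Real.exp (z.re * t) * (‖X 0‖ + C / r * (Real.exp (r * t) - 1)) := by gcongr
    _ ≤ Real.exp (z.re * t) * (‖X 0‖ * Real.exp (r * t) + C / r * Real.exp (r * t)) := by
        have h2 : 1 ≤ Real.exp (r * t) := Real.one_le_exp (by positivity)
        have h3 : 0 ≤ C / r := by positivity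
        have h4 := norm_nonneg (X 0)
        gcongr
        · nlinarith
        · linarith
    _ = (‖X 0‖ + C / r) * Real.exp (-β * t) := by
        have : Real.exp (-β * t) = Real.exp (z.re * t) * Real.exp (r * t) := by
          rw [← Real.exp_add]; congr 1; rw [hr]; ring
        rw [this]; ring

/-- Peel off one root at a time: `B = A - z` commutes with `A`, so `B X` is a solution annihilated
by the remaining factors, and `X' = z X + B X` is a scalar-coefficient equation with decaying input.
As every root lies strictly left of `-β`, repeated roots cost no polynomial factor and no Jordan
form is needed. -/
lemma exists_decay_of_aeval_eq_zero {N : ℕ} (A : Matrix (Fin N) (Fin N) ℂ) {β : ℝ}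
    (s : Multiset ℂ) (hs : ∀ z ∈ s, z.re < -β) :
    ∃ C : ℝ, 0 ≤ C ∧ ∀ X : ℝ → Fin N → ℂ,
      (∀ t, 0 ≤ t → HasDerivWithinAt X (A *ᵥ X t) (Ici 0) t) →
      (∀ t, 0 ≤ t → Polynomial.aeval A
        (s.map fun z => Polynomial.X - Polynomial.C z).prod *ᵥ X t = 0) →
      ∀ t, 0 ≤ t → ‖X t‖ ≤ C * ‖X 0‖ * Real.exp (-β * t) := by
  induction s using Multiset.induction_on with
  | empty =>
    refine ⟨0, le_rfl, fun X _ h0 t ht => ?_⟩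
    have := h0 t ht
    simp only [Multiset.map_zero, Multiset.prod_zero, map_one, one_mulVec] at this
    simp [this]
  | cons z s ih =>
    obtain ⟨C, hC, ih⟩ := ih fun w hw => hs w (Multiset.mem_cons_of_mem hw)
    have hz := hs z (Multiset.mem_cons_self z s)
    set B := A - algebraMap ℂ _ z with hB
    obtain ⟨K, hK0, hK⟩ := exists_mulVec_norm_le B
    have hr : 0 < -z.re - β := by linarith
    refine ⟨1 + C * K / (-z.re - β), by positivity, fun X hX h0 t ht => ?_⟩
    have hBX : ∀ x : Fin N → ℂ, B *ᵥ x = A *ᵥ x - z • x := fun x => by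
      rw [hB, sub_mulVec, Algebra.algebraMap_eq_smul_one, smul_mulVec, one_mulVec]
    have hF := ih (fun t => B *ᵥ X t) (fun t ht => by
        have h := hasDerivWithinAt_mulVec B (hX t ht)
        have hcomm : A *ᵥ (B *ᵥ X t) = B *ᵥ (A *ᵥ X t) := by
          rw [hBX, hBX, mulVec_sub, mulVec_smul]
        rwa [hcomm])
      (fun t ht => by
        have h := h0 t ht
        rw [Multiset.map_cons, Multiset.prod_cons, mul_comm, map_mul, ← mulVec_mulVec] at h
        simpa [hB] using h)
    have := norm_le_of_hasDerivWithinAt_smul_add (C := C * ‖B *ᵥ X 0‖) hz hF (fun t ht => by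
      have h := hX t ht
      simp only [hBX]
      rwa [add_sub_cancel]) ht
    refine this.trans ?_
    gcongr
    have h1 : C * ‖B *ᵥ X 0‖ ≤ C * (K * ‖X 0‖) := by gcongr; exact hK _
    calc ‖X 0‖ + C * ‖B *ᵥ X 0‖ / (-z.re - β) ≤ ‖X 0‖ + C * (K * ‖X 0‖) / (-z.re - β) := by gcongr
      _ = _ := by ring

/-- Solutions of `x' = A x` decay exponentially if the eigenvalues of `A` have negative real
part. -/
theorem exists_decay_of_spectrum {N : ℕ} (A : Matrix (Fin N) (Fin N) ℂ)
    (hA : ∀ z ∈ spectrum ℂ A, z.re < 0) :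
    ∃ β C : ℝ, 0 < β ∧ 0 ≤ C ∧ ∀ X : ℝ → Fin N → ℂ,
      (∀ t, 0 ≤ t → HasDerivWithinAt X (A *ᵥ X t) (Ici 0) t) →
      ∀ t, 0 ≤ t → ‖X t‖ ≤ C * ‖X 0‖ * Real.exp (-β * t) := by
  obtain ⟨β, hβ, h⟩ := exists_neg_bound A.charpoly.roots fun z hz =>
    hA z (mem_spectrum_iff_isRoot_charpoly.2 (Polynomial.isRoot_of_mem_roots hz))
  obtain ⟨C, hC, h⟩ := exists_decay_of_aeval_eq_zero A A.charpoly.roots h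
  refine ⟨β, C, hβ, hC, fun X hX => h X hX fun t _ => ?_⟩
  rw [← (IsAlgClosed.splits A.charpoly).eq_prod_roots_of_monic A.charpoly_monic,
    Matrix.aeval_self_charpoly, zero_mulVec]

/-! ### Companion matrices acting on exponential sums. -/

/-- The value `μ^N + ∑ c_j μ^{j-1}` at `μ` of the characteristic polynomial of `companion c`. -/
noncomputable def charEval {N : ℕ} (c : Fin N → ℝ) (μ : ℂ) : ℂ :=
  μ ^ N + ∑ j, (c j : ℂ) * μ ^ (j : ℕ)

/-- The vector of the first `N` derivatives of the exponential sum `∑ γ_k e^{μ_k t}`. -/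
noncomputable def expJet {n : ℕ} (N : ℕ) (μ γ : Fin n → ℂ) (t : ℝ) : Fin N → ℂ :=
  fun i => ∑ k, γ k * Complex.exp (μ k * t) * μ k ^ (i : ℕ)

/-- The complex Hankel matrix of `θ ∈ ℂ^{2n}`. -/
def complexHankel {n : ℕ} (θ : Fin (2 * n) → ℂ) : Matrix (Fin n) (Fin n) ℂ :=
  Matrix.of fun i j => θ ⟨(i : ℕ) + (j : ℕ), by omega⟩

/-- The second half of a vector `θ ∈ ℂ^{2n}`. -/
def complexSecondHalf {n : ℕ} (θ : Fin (2 * n) → ℂ) : Fin n → ℂ :=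
  fun i => θ ⟨n + (i : ℕ), by omega⟩

lemma companion_map_mulVec_apply {N : ℕ} (c : Fin N → ℝ) (x : Fin N → ℂ) (i : Fin N) :
    ((companion c).map Complex.ofReal *ᵥ x) i =
      if h : (i : ℕ) + 1 < N then x ⟨i + 1, h⟩ else -∑ j, (c j : ℂ) * x j := by
  simp only [mulVec, dotProduct, companion, map_apply, of_apply]
  split_ifs with h h1 h1
  · omega
  · rw [← Finset.sum_neg_distrib]
    exact Finset.sum_congr rfl fun j _ => by push_cast; ring
  · rw [Finset.sum_eq_single ⟨i + 1, h1⟩]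
    · simp
    · intro j _ hj
      rw [if_neg fun h => hj (Fin.ext h)]
      simp
    · simp
  · omega

/-- The vector of powers of `μ` fails to be an eigenvector only in its last entry, by `charEval c
μ`. The spectrum, the steady state and the action of `Ξ` all rest on this. -/
lemma companion_map_mulVec_pow {N : ℕ} (c : Fin N → ℝ) (μ : ℂ) :
    (companion c).map Complex.ofReal *ᵥ (fun i => μ ^ (i : ℕ)) =
      fun i : Fin N => μ * μ ^ (i : ℕ) - if (i : ℕ) + 1 = N then charEval c μ else 0 := by
  funext i
  rw [companion_map_mulVec_apply]
  split_ifs with h h1 h1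
  · omega
  · rw [pow_succ']; ring
  · rw [charEval, ← pow_succ', h1]; ring
  · omega

lemma mem_spectrum_companion {N : ℕ} (hN : 0 < N) (c : Fin N → ℝ) {μ : ℂ}
    (h : charEval c μ = 0) : μ ∈ spectrum ℂ ((companion c).map Complex.ofReal) := by
  rw [← Matrix.spectrum_toLin', ← Module.End.hasEigenvalue_iff_mem_spectrum]
  refine Module.End.hasEigenvalue_of_hasEigenvector (x := fun i : Fin N => μ ^ (i : ℕ)) ⟨?_, ?_⟩
  · rw [Module.End.mem_eigenspace_iff, toLin'_apply, companion_map_mulVec_pow, h]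
    funext i
    simp
  · intro h0
    simpa using congr_fun h0 ⟨0, hN⟩

lemma hasDerivAt_exp_mul (μ : ℂ) (t : ℝ) :
    HasDerivAt (fun s : ℝ => Complex.exp (μ * s)) (μ * Complex.exp (μ * t)) t := by
  have h : HasDerivAt (fun s : ℝ => μ * (s : ℂ)) μ t := by
    simpa using (Complex.ofRealCLM.hasDerivAt (x := t)).const_mul μ
  rw [mul_comm μ (Complex.exp _)]
  exact h.cexp

lemma hasDerivAt_expSum {n : ℕ} (μ b : Fin n → ℂ) (t : ℝ) :
    HasDerivAt (fun t : ℝ => ∑ k, b k * Complex.exp (μ k * t))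
      (∑ k, b k * μ k * Complex.exp (μ k * t)) t :=
  HasDerivAt.fun_sum fun k _ =>
    ((hasDerivAt_exp_mul (μ k) t).const_mul (b k)).congr_deriv (by ring)

/-- Exponentials with distinct exponents are linearly independent on `[0, ∞)`. -/
lemma expSum_eq_zero {n : ℕ} {μ b : Fin n → ℂ} (hμ : Function.Injective μ)
    (h : ∀ t : ℝ, 0 ≤ t → ∑ k, b k * Complex.exp (μ k * t) = 0) : b = 0 := by
  -- All derivatives vanish, one-sidedly at `0`; evaluated there they are the power moments of `b`.
  have key : ∀ i : ℕ, ∀ t : ℝ, 0 ≤ t → ∑ k, b k * μ k ^ i * Complex.exp (μ k * t) = 0 := by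
    intro i
    induction i with
    | zero => simpa using h
    | succ i ih =>
      intro t ht
      have h1 := (hasDerivAt_expSum μ (fun k => b k * μ k ^ i) t).hasDerivWithinAt (s := Ici 0)
      have h2 : HasDerivWithinAt (fun t : ℝ => ∑ k, b k * μ k ^ i * Complex.exp (μ k * t)) 0
          (Ici 0) t := (hasDerivWithinAt_const t (Ici 0) (0 : ℂ)).congr_of_mem ih ht
      have := (uniqueDiffOn_Ici (0 : ℝ) t ht).eq_deriv _ h1 h2
      rw [← this]
      exact Finset.sum_congr rfl fun k _ => by rw [pow_succ]; ring
  refine eq_zero_of_forall_pow_sum_mul_pow_eq_zero hμ fun i => ?_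
  simpa using key i 0 le_rfl

lemma hasDerivAt_expJet {n N : ℕ} (μ γ : Fin n → ℂ) (t : ℝ) :
    HasDerivAt (expJet N μ γ) (expJet N μ (fun k => γ k * μ k) t) t := by
  rw [hasDerivAt_pi]
  intro i
  have := hasDerivAt_expSum μ (fun k => γ k * μ k ^ (i : ℕ)) t
  simp only [expJet]
  refine (this.congr_deriv ?_).congr_of_eventuallyEq (Eventually.of_forall fun s => ?_)
  · exact Finset.sum_congr rfl fun k _ => by ring
  · exact Finset.sum_congr rfl fun k _ => by ring

lemma expJet_eq_sum {n N : ℕ} (μ γ : Fin n → ℂ) (t : ℝ) :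
    expJet N μ γ t = ∑ k, (γ k * Complex.exp (μ k * t)) • fun i : Fin N => μ k ^ (i : ℕ) := by
  funext i
  simp [expJet, Finset.sum_apply]

/-- Rearranged, the jet solves the companion system driven through its last entry: it is the steady
state of the filter. -/
lemma companion_map_mulVec_expJet {n N : ℕ} (c : Fin N → ℝ) (μ γ : Fin n → ℂ) (t : ℝ) :
    (companion c).map Complex.ofReal *ᵥ expJet N μ γ t =
      expJet N μ (fun k => γ k * μ k) t -
        fun i : Fin N => if (i : ℕ) + 1 = N then
          ∑ k, γ k * charEval c (μ k) * Complex.exp (μ k * t) else 0 := by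
  rw [expJet_eq_sum, mulVec_sum]
  simp only [mulVec_smul, companion_map_mulVec_pow]
  funext i
  simp only [Finset.sum_apply, Pi.smul_apply, Pi.sub_apply, smul_eq_mul, mul_sub,
    Finset.sum_sub_distrib, expJet]
  congr 1
  · exact Finset.sum_congr rfl fun k _ => by ring
  · split_ifs
    · exact Finset.sum_congr rfl fun k _ => by ring
    · simp

/-! ### Uniform invertibility of the steady-state Hankel matrix. -/

lemma norm_exp_mul_of_re_eq_zero {μ : ℂ} (h : μ.re = 0) (t : ℝ) : ‖Complex.exp (μ * t)‖ = 1 := by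
  rw [Complex.norm_exp]; simp [h]

lemma exists_norm_expJet_le {n N : ℕ} {μ γ : Fin n → ℂ} (hμ : ∀ k, (μ k).re = 0) :
    ∃ B : ℝ, ∀ t, ‖expJet N μ γ t‖ ≤ B := by
  refine ⟨∑ k, ‖γ k‖ * ‖fun i : Fin N => μ k ^ (i : ℕ)‖, fun t => ?_⟩
  rw [expJet_eq_sum]
  refine (norm_sum_le _ _).trans (Finset.sum_le_sum fun k _ => ?_)
  rw [norm_smul, norm_mul, norm_exp_mul_of_re_eq_zero (hμ k), mul_one]

lemma exists_le_norm_mulVec {N : ℕ} {A : Matrix (Fin N) (Fin N) ℂ} (hA : A.det ≠ 0) :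
    ∃ c : ℝ, 0 < c ∧ ∀ x : Fin N → ℂ, c * ‖x‖ ≤ ‖A *ᵥ x‖ := by
  obtain ⟨K, hK0, hK⟩ := exists_mulVec_norm_le A⁻¹
  refine ⟨(K + 1)⁻¹, by positivity, fun x => ?_⟩
  have h := hK (A *ᵥ x)
  rw [mulVec_mulVec, nonsing_inv_mul A (isUnit_iff_ne_zero.2 hA), one_mulVec] at h
  rw [inv_mul_le_iff₀ (by positivity)]
  linarith [norm_nonneg (A *ᵥ x)]

/-- The factorization `Vᵀ D(t) V`, from `μ^(i+j) = μ^i μ^j`. -/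
lemma complexHankel_expJet_mulVec {n : ℕ} (μ γ : Fin n → ℂ) (t : ℝ) (x : Fin n → ℂ) :
    complexHankel (expJet (2 * n) μ γ t) *ᵥ x =
      (vandermonde μ)ᵀ *ᵥ fun k => γ k * Complex.exp (μ k * t) * (vandermonde μ *ᵥ x) k := by
  funext i
  simp only [mulVec, dotProduct, complexHankel, of_apply, expJet, transpose_apply,
    vandermonde_apply, Finset.sum_mul, Finset.mul_sum]
  rw [Finset.sum_comm]
  exact Finset.sum_congr rfl fun k _ => Finset.sum_congr rfl fun j _ => by rw [pow_add]; ring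

/-- The Hankel matrix of a sum of `n` exponentials with distinct imaginary exponents is uniformly
bounded below. -/
lemma exists_le_norm_complexHankel_expJet {n : ℕ} {μ γ : Fin n → ℂ} (hμ : Function.Injective μ)
    (hre : ∀ k, (μ k).re = 0) (hγ : ∀ k, γ k ≠ 0) :
    ∃ σ : ℝ, 0 < σ ∧ ∀ t x, σ * ‖x‖ ≤ ‖complexHankel (expJet (2 * n) μ γ t) *ᵥ x‖ := by
  have hdet : (vandermonde μ).det ≠ 0 := det_vandermonde_ne_zero_iff.2 hμ
  obtain ⟨c₁, hc₁, h₁⟩ := exists_le_norm_mulVec hdet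
  obtain ⟨c₂, hc₂, h₂⟩ := exists_le_norm_mulVec (A := (vandermonde μ)ᵀ) (by rwa [det_transpose])
  obtain ⟨g, hg, hgγ⟩ : ∃ g : ℝ, 0 < g ∧ ∀ k, g ≤ ‖γ k‖ := by
    rcases isEmpty_or_nonempty (Fin n) with h | h
    · exact ⟨1, one_pos, fun k => h.elim k⟩
    · obtain ⟨k, hk⟩ := Finite.exists_min fun k => ‖γ k‖
      exact ⟨‖γ k‖, norm_pos_iff.2 (hγ k), hk⟩
  refine ⟨c₂ * (g * c₁), by positivity, fun t x => ?_⟩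
  rw [complexHankel_expJet_mulVec]
  refine le_trans ?_ (h₂ _)
  rw [mul_assoc]
  gcongr
  rw [mul_assoc]
  have h3 : g * ‖vandermonde μ *ᵥ x‖ ≤
      ‖fun k => γ k * Complex.exp (μ k * t) * (vandermonde μ *ᵥ x) k‖ := by
    rw [mul_comm, ← le_div_iff₀ hg]
    refine (pi_norm_le_iff_of_nonneg (by positivity)).2 fun k => ?_
    rw [le_div_iff₀ hg, mul_comm]
    refine le_trans ?_ (norm_le_pi_norm _ k)
    rw [norm_mul, norm_mul, norm_exp_mul_of_re_eq_zero (hre k), mul_one]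
    gcongr
    exact hgγ k
  refine le_trans ?_ h3
  gcongr
  exact h₁ x

/-- Row `i` is the sum over `k` of `γ_k e^{μ_k t} μ_k^i charEval a (μ k)`, so the true parameter
leaves no regression residual on the steady state. -/
lemma complexHankel_expJet_mulVec_add {n : ℕ} {a : Fin n → ℝ} {μ : Fin n → ℂ}
    (h : ∀ k, charEval a (μ k) = 0) (γ : Fin n → ℂ) (t : ℝ) :
    complexHankel (expJet (2 * n) μ γ t) *ᵥ (fun i => (a i : ℂ)) +
      complexSecondHalf (expJet (2 * n) μ γ t) = 0 := by
  funext i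
  simp only [mulVec, dotProduct, complexHankel, of_apply, expJet, complexSecondHalf, Pi.add_apply,
    Finset.sum_mul, Pi.zero_apply]
  rw [Finset.sum_comm, ← Finset.sum_add_distrib]
  refine Finset.sum_eq_zero fun k _ => ?_
  have h1 : γ k * Complex.exp (μ k * t) * μ k ^ (i : ℕ) * charEval a (μ k) = 0 := by
    rw [h, mul_zero]
  rw [charEval, mul_add, Finset.mul_sum] at h1
  rw [← h1, add_comm]
  congr 1
  · rw [pow_add]; ring
  · exact Finset.sum_congr rfl fun j _ => by rw [pow_add]; ring

/-! ### Modes of the exosystem and inversion of the filter. -/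

/-- The superdiagonal rows say that each coordinate is the derivative of the preceding one. -/
lemma exosystem_eq_expJet {n : ℕ} {a : Fin n → ℝ} {v : ℝ → Fin n → ℝ}
    (hv : IsExosystemSolution a v) {μ c : Fin n → ℂ}
    (hy : ∀ t : ℝ, 0 ≤ t → ((Gam n ⬝ᵥ v t : ℝ) : ℂ) = ∑ k, c k * Complex.exp (μ k * t)) :
    ∀ t : ℝ, 0 ≤ t → (fun i => (v t i : ℂ)) = expJet n μ c t := by
  have key : ∀ i : ℕ, ∀ hi : i < n, ∀ t : ℝ, 0 ≤ t →
      (v t ⟨i, hi⟩ : ℂ) = ∑ k, c k * μ k ^ i * Complex.exp (μ k * t) := by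
    intro i
    induction i with
    | zero =>
      intro hi t ht
      have h : Gam n ⬝ᵥ v t = v t ⟨0, hi⟩ := by
        rw [dotProduct, Finset.sum_eq_single ⟨0, hi⟩]
        · simp [Gam]
        · intro j _ hj
          have : (j : ℕ) ≠ 0 := fun h => hj (Fin.ext h)
          simp [Gam, this]
        · simp
      rw [← h, hy t ht]
      simp
    | succ i ih =>
      intro hi t ht
      have h1 := (hasDerivWithinAt_pi.1 (hv t ht) ⟨i, by omega⟩).ofReal_comp
      have h2 := (hasDerivAt_expSum μ (fun k => c k * μ k ^ i) t).hasDerivWithinAt (s := Ici 0)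
      have h3 := (uniqueDiffOn_Ici (0 : ℝ) t ht).eq_deriv _ h1
        (h2.congr_of_mem (fun s hs => ih (by omega) s hs) ht)
      have h4 : ((companion a *ᵥ v t) ⟨i, by omega⟩ : ℂ) = v t ⟨i + 1, hi⟩ := by
        have h5 := companion_map_mulVec_apply a (fun i => (v t i : ℂ)) ⟨i, by omega⟩
        rw [dif_pos hi] at h5
        rw [← h5]
        exact RingHom.map_mulVec Complex.ofRealHom (companion a) (v t) _
      rw [← h4, h3]
      exact Finset.sum_congr rfl fun k _ => by rw [pow_succ]; ring
  intro t ht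
  funext i
  rw [key i i.2 t ht]
  exact Finset.sum_congr rfl fun k _ => by ring

/-- The exponents present in the output of the exosystem are zeros of its characteristic
polynomial. -/
lemma charEval_eq_zero_of_exosystem {n : ℕ} (hn : 0 < n) {a : Fin n → ℝ} {v : ℝ → Fin n → ℝ}
    (hv : IsExosystemSolution a v) {μ c : Fin n → ℂ} (hμ : Function.Injective μ)
    (hc : ∀ k, c k ≠ 0)
    (hy : ∀ t : ℝ, 0 ≤ t → ((Gam n ⬝ᵥ v t : ℝ) : ℂ) = ∑ k, c k * Complex.exp (μ k * t)) (k : Fin n) :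
    charEval a (μ k) = 0 := by
  have hjet := exosystem_eq_expJet hv hy
  -- The last row makes the jet's defect vanish for all `t ≥ 0`; independence of exponentials kills
  -- each coefficient.
  have h0 : (fun k => c k * charEval a (μ k)) = 0 := by
    refine expSum_eq_zero hμ fun t ht => ?_
    have h1 : HasDerivWithinAt (fun t i => (v t i : ℂ)) (fun i => ((companion a *ᵥ v t) i : ℂ))
        (Ici 0) t :=
      hasDerivWithinAt_pi.2 fun i => (hasDerivWithinAt_pi.1 (hv t ht) i).ofReal_comp
    have h2 := (hasDerivAt_expJet (N := n) μ c t).hasDerivWithinAt (s := Ici 0)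
    have h3 := (uniqueDiffOn_Ici (0 : ℝ) t ht).eq_deriv _ h1 (h2.congr_of_mem hjet ht)
    have h4 : (fun i => ((companion a *ᵥ v t) i : ℂ)) =
        (companion a).map Complex.ofReal *ᵥ fun i => (v t i : ℂ) :=
      funext (RingHom.map_mulVec Complex.ofRealHom (companion a) (v t))
    rw [h4, hjet t ht, companion_map_mulVec_expJet, sub_eq_self] at h3
    simpa [Nat.sub_add_cancel hn] using congr_fun h3 ⟨n - 1, by omega⟩
  exact (mul_eq_zero.1 (congr_fun h0 k)).resolve_left (hc k)

lemma Xi_map {n : ℕ} (mc : Fin (2 * n) → ℝ) (a : Fin n → ℝ) :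
    (Xi mc a).map Complex.ofReal = (companion a).map Complex.ofReal ^ (2 * n) +
      ∑ j : Fin (2 * n), (mc j : ℂ) • (companion a).map Complex.ofReal ^ (j : ℕ) := by
  have hm : ∀ A : Matrix (Fin n) (Fin n) ℝ,
      A.map Complex.ofReal = Complex.ofRealHom.mapMatrix A := fun A => rfl
  have hs : ∀ (r : ℝ) (A : Matrix (Fin n) (Fin n) ℝ),
      Complex.ofRealHom.mapMatrix (r • A) = (r : ℂ) • Complex.ofRealHom.mapMatrix A := by
    intro r A
    ext i j
    simp
  simp only [hm, Xi, map_add, map_pow, map_sum, hs]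

/-- `Ξ(a)` is a polynomial in `Φ(a)`, so it acts on an eigenvector by its value at the eigenvalue;
this cancels the filter gain. -/
lemma Xi_map_mulVec_pow {n : ℕ} (mc : Fin (2 * n) → ℝ) {a : Fin n → ℝ} {μ : ℂ}
    (h : charEval a μ = 0) :
    (Xi mc a).map Complex.ofReal *ᵥ (fun i => μ ^ (i : ℕ)) =
      charEval mc μ • fun i : Fin n => μ ^ (i : ℕ) := by
  have h1 : (companion a).map Complex.ofReal *ᵥ (fun i => μ ^ (i : ℕ)) =
      μ • fun i : Fin n => μ ^ (i : ℕ) := by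
    rw [companion_map_mulVec_pow, h]
    funext i
    simp
  have h2 : ∀ l : ℕ, (companion a).map Complex.ofReal ^ l *ᵥ (fun i => μ ^ (i : ℕ)) =
      μ ^ l • fun i : Fin n => μ ^ (i : ℕ) := by
    intro l
    induction l with
    | zero => simp
    | succ l ih => rw [pow_succ, ← mulVec_mulVec, h1, mulVec_smul, ih, smul_smul, pow_succ']
  rw [Xi_map, add_mulVec, sum_mulVec]
  simp only [smul_mulVec, h2, charEval, add_smul, Finset.sum_smul, smul_smul]

/-- The output map recovers the output of the exosystem on the steady state. -/
lemma outputMap_re_expJet {n : ℕ} (hn : 0 < n) (mc : Fin (2 * n) → ℝ) {a : Fin n → ℝ}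
    {μ γ : Fin n → ℂ} (h : ∀ k, charEval a (μ k) = 0) (t : ℝ) :
    outputMap mc (fun i => (expJet (2 * n) μ γ t i).re) a =
      (∑ k, γ k * charEval mc (μ k) * Complex.exp (μ k * t)).re := by
  have h1 : ∀ x : Fin n → ℝ, Gam n ⬝ᵥ x = x ⟨0, hn⟩ := by
    intro x
    rw [dotProduct, Finset.sum_eq_single ⟨0, hn⟩]
    · simp [Gam]
    · intro j _ hj
      have : (j : ℕ) ≠ 0 := fun h => hj (Fin.ext h)
      simp [Gam, this]
    · simp
  have h2 : ((Xi mc a).map Complex.ofReal *ᵥ expJet n μ γ t) ⟨0, hn⟩ =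
      ∑ k, γ k * charEval mc (μ k) * Complex.exp (μ k * t) := by
    rw [expJet_eq_sum, mulVec_sum]
    simp only [mulVec_smul, Xi_map_mulVec_pow mc (h _), Finset.sum_apply, Pi.smul_apply,
      smul_eq_mul, pow_zero]
    exact Finset.sum_congr rfl fun k _ => by ring
  rw [outputMap, h1, ← h2]
  simp only [mulVec, dotProduct, map_apply, Complex.re_sum, Complex.re_ofReal_mul]
  rfl

/-! ### Existence of observer solutions. -/

lemma norm_mulVec_le_sum {N : ℕ} (A : Matrix (Fin N) (Fin N) ℝ) (x : Fin N → ℝ) :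
    ‖A *ᵥ x‖ ≤ (∑ i, ∑ j, |A i j|) * ‖x‖ := by
  refine (pi_norm_le_iff_of_nonneg (by positivity)).2 fun i => ?_
  calc ‖(A *ᵥ x) i‖ ≤ ∑ j, |A i j| * ‖x‖ := by
        simp only [mulVec, dotProduct]
        refine (norm_sum_le _ _).trans (Finset.sum_le_sum fun j _ => ?_)
        rw [norm_mul, Real.norm_eq_abs]
        gcongr
        exact norm_le_pi_norm x j
    _ = (∑ j, |A i j|) * ‖x‖ := by rw [Finset.sum_mul]
    _ ≤ _ := by
        refine mul_le_mul_of_nonneg_right ?_ (norm_nonneg x)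
        exact Finset.single_le_sum (f := fun i => ∑ j, |A i j|)
          (fun i _ => Finset.sum_nonneg fun j _ => abs_nonneg _) (Finset.mem_univ i)

/-- Linear time-varying systems with continuous coefficients have solutions on `[0, ∞)`. -/
theorem exists_linear_solution {N : ℕ} {B : ℝ → Matrix (Fin N) (Fin N) ℝ} {g : ℝ → Fin N → ℝ}
    (hB : ∀ i j, ContinuousOn (fun t => B t i j) (Ici 0)) (hg : ContinuousOn g (Ici 0))
    (x₀ : Fin N → ℝ) :
    ∃ x : ℝ → Fin N → ℝ, x 0 = x₀ ∧
      ∀ t, 0 ≤ t → HasDerivWithinAt x (B t *ᵥ x t + g t) (Ici 0) t := by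
  refine exists_solution_Ici (f := fun t x => B t *ᵥ x + g t) (fun x => ?_) (fun T => ?_) x₀
  · refine ContinuousOn.add (continuousOn_pi.2 fun i => ?_) hg
    simp only [mulVec, dotProduct]
    exact continuousOn_finsetSum _ fun j _ => (hB i j).mul continuousOn_const
  · have hc : ContinuousOn (fun t => ∑ i, ∑ j, |B t i j|) (Icc 0 T) :=
      (continuousOn_finsetSum _ fun i _ => continuousOn_finsetSum _ fun j _ =>
        (hB i j).abs).mono Icc_subset_Ici_self
    obtain ⟨K, hK⟩ := isCompact_Icc.exists_bound_of_continuousOn hc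
    refine ⟨K.toNNReal, fun t ht => LipschitzWith.of_dist_le_mul fun x y => ?_⟩
    rw [dist_eq_norm, dist_eq_norm, add_sub_add_right_eq_sub, ← mulVec_sub]
    refine (norm_mulVec_le_sum _ _).trans ?_
    gcongr
    exact (le_abs_self _).trans ((hK t ht).trans (Real.le_coe_toNNReal K))

/-- The observer is a cascade: once `η` is found, the equation for `â` is linear with continuous
coefficients. -/
lemma exists_observer_solution {n : ℕ} (mc : Fin (2 * n) → ℝ) (k₁ : ℝ) {y : ℝ → ℝ}
    (hy : ContinuousOn y (Ici 0)) (η₀ : Fin (2 * n) → ℝ) (ah₀ : Fin n → ℝ) :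
    ∃ (η : ℝ → Fin (2 * n) → ℝ) (ah : ℝ → Fin n → ℝ),
      IsObserverSolution mc k₁ y η ah ∧ η 0 = η₀ ∧ ah 0 = ah₀ := by
  obtain ⟨η, hη0, hη⟩ := exists_linear_solution (B := fun _ => companion mc)
    (g := fun t => y t • inputVec n) (fun _ _ => continuousOn_const)
    (hy.smul continuousOn_const) η₀
  have hηc : ∀ i, ContinuousOn (fun t => η t i) (Ici 0) := fun i t ht =>
    (hasDerivWithinAt_pi.1 (hη t ht) i).continuousWithinAt
  obtain ⟨ah, hah0, hah⟩ := exists_linear_solution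
    (B := fun t => -(k₁ • ((Hankel (η t))ᵀ * Hankel (η t))))
    (g := fun t => -(k₁ • (Hankel (η t))ᵀ *ᵥ secondHalf (η t)))
    (fun i j => by
      simp only [Matrix.neg_apply, Matrix.smul_apply, mul_apply, transpose_apply, Hankel, of_apply]
      exact ((continuousOn_finsetSum _ fun l _ => (hηc _).fun_mul (hηc _)).const_smul k₁).fun_neg)
    (continuousOn_pi.2 fun i => by
      simp only [Pi.neg_apply, Pi.smul_apply, mulVec, dotProduct, transpose_apply, Hankel,
        of_apply, secondHalf]
      exact ((continuousOn_finsetSum _ fun l _ =>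
        (hηc _).fun_mul (hηc _)).const_smul k₁).fun_neg) ah₀
  refine ⟨η, ah, fun t ht => ⟨hη t ht, (hah t ht).congr_deriv ?_⟩, hη0, hah0⟩
  rw [mulVec_add, mulVec_mulVec, smul_add, neg_add, neg_mulVec, smul_mulVec]

/-! ### Multi-tone signals as exponential sums. -/

lemma exists_fin_expSum {ι : Type*} [Fintype ι] {n : ℕ} (hn : Fintype.card ι = n)
    {μ c : ι → ℂ} (hμ : Function.Injective μ) (hre : ∀ k, (μ k).re = 0) (hc : ∀ k, c k ≠ 0) :
    ∃ μ' c' : Fin n → ℂ, Function.Injective μ' ∧ (∀ k, (μ' k).re = 0) ∧ (∀ k, c' k ≠ 0) ∧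
      ∀ t : ℝ, ∑ k, c' k * Complex.exp (μ' k * t) = ∑ k, c k * Complex.exp (μ k * t) := by
  let e : Fin n ≃ ι := (Fintype.equivFinOfCardEq hn).symm
  exact ⟨μ ∘ e, c ∘ e, hμ.comp e.injective, fun k => hre _, fun k => hc _, fun t =>
    e.sum_comp fun k => c k * Complex.exp (μ k * t)⟩

/-- A multi-tone signal is a sum of exponentials with distinct imaginary exponents and nonzero
coefficients. -/
lemma exists_expSum_of_multitone {m n : ℕ} {d₀ : ℝ} {d ω : Fin m → ℝ} (φ : Fin m → ℝ)
    (hd : ∀ k, d k ≠ 0) (hω : ∀ k, ω k ≠ 0) (hωdist : Function.Injective fun k => |ω k|)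
    (hdim : (d₀ = 0 ∧ n = 2 * m) ∨ (d₀ ≠ 0 ∧ n = 2 * m + 1)) :
    ∃ μ c : Fin n → ℂ, Function.Injective μ ∧ (∀ k, (μ k).re = 0) ∧ (∀ k, c k ≠ 0) ∧
      ∀ t : ℝ, ((d₀ + ∑ k, d k * Real.sin (ω k * t + φ k) : ℝ) : ℂ) =
        ∑ k, c k * Complex.exp (μ k * t) := by
  let μ : Fin m ⊕ Fin m → ℂ := Sum.elim (fun k => ω k * Complex.I) fun k => -(ω k * Complex.I)
  let c : Fin m ⊕ Fin m → ℂ :=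
    Sum.elim (fun k => -(d k * Complex.I / 2) * Complex.exp (φ k * Complex.I))
      fun k => d k * Complex.I / 2 * Complex.exp (-(φ k * Complex.I))
  have hre : ∀ k, (μ k).re = 0 := by rintro (k | k) <;> simp [μ]
  have hne : ∀ k, (μ k).im ≠ 0 := by rintro (k | k) <;> simp [μ, hω]
  have hc : ∀ k, c k ≠ 0 := by rintro (k | k) <;> simp [c, hd, Complex.exp_ne_zero]
  have hμ : Function.Injective μ := by
    have hr : ∀ k, (μ (Sum.inl k)).im = ω k := fun k => by simp [μ]
    have hl : ∀ k, (μ (Sum.inr k)).im = -ω k := fun k => by simp [μ]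
    -- Opposite frequencies would have equal absolute value, hence equal index, hence be zero.
    have hcross : ∀ k l, ω k ≠ -ω l := by
      intro k l h
      have hkl : k = l := hωdist (by simp [h])
      subst hkl
      exact hω k (by linarith)
    rintro (k | k) (l | l) h <;> have h := congr_arg Complex.im h <;> simp only [hr, hl] at h
    · rw [hωdist (a₁ := k) (a₂ := l) (by simp [h])]
    · exact absurd h (hcross k l)
    · exact absurd h.symm (hcross l k)
    · rw [hωdist (a₁ := k) (a₂ := l) (by simp [neg_injective h])]
  have hsum : ∀ t : ℝ, ((∑ k, d k * Real.sin (ω k * t + φ k) : ℝ) : ℂ) =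
      ∑ k, c k * Complex.exp (μ k * t) := by
    intro t
    rw [Fintype.sum_sum_type, ← Finset.sum_add_distrib]
    push_cast
    refine Finset.sum_congr rfl fun k _ => ?_
    simp only [μ, c, Sum.elim_inl, Sum.elim_inr]
    rw [mul_assoc (-(_ : ℂ)) (Complex.exp _), mul_assoc (_ / 2) (Complex.exp _),
      ← Complex.exp_add, ← Complex.exp_add, Complex.sin]
    rw [show -((ω k : ℂ) * t + φ k) * Complex.I = -(φ k * Complex.I) + -(ω k * Complex.I) * t by
      ring, show ((ω k : ℂ) * t + φ k) * Complex.I = φ k * Complex.I + ω k * Complex.I * t by ring]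
    ring
  rcases hdim with ⟨h0, hn⟩ | ⟨h0, hn⟩
  · obtain ⟨μ', c', h1, h2, h3, h4⟩ := exists_fin_expSum (n := n) (by simp [hn]; ring) hμ hre hc
    refine ⟨μ', c', h1, h2, h3, fun t => ?_⟩
    rw [h4, h0, zero_add, hsum]
  -- The bias is the extra mode `none` with exponent `0`, distinct from the others since their
  -- imaginary parts are nonzero.
  · obtain ⟨μ', c', h1, h2, h3, h4⟩ := exists_fin_expSum (ι := Option (Fin m ⊕ Fin m)) (n := n)
      (μ := fun k => k.elim 0 μ) (c := fun k => k.elim (d₀ : ℂ) c) (by simp [hn]; ring)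
      (by
        rintro (_ | k) (_ | l) h
        · rfl
        · exact absurd (congr_arg Complex.im h).symm (hne l)
        · exact absurd (congr_arg Complex.im h) (hne k)
        · rw [hμ h])
      (by rintro (_ | k); exacts [rfl, hre k])
      (by rintro (_ | k); exacts [Complex.ofReal_ne_zero.2 h0, hc k])
    refine ⟨μ', c', h1, h2, h3, fun t => ?_⟩
    rw [h4, Fintype.sum_option, Complex.ofReal_add, hsum]
    simp

/-! ### Perturbed differential inequalities and regularity of the output map. -/

/-- An exponentially perturbed differential inequality `V' ≤ -γ V` still yields exponential
decay. -/
lemma decay_of_deriv_le {V V' : ℝ → ℝ} {γ β C₁ C₂ l : ℝ} (hβ : 0 < β) (hC₁ : 0 ≤ C₁)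
    (hC₂ : 0 ≤ C₂) (hlγ : l ≤ γ) (hlβ : l < β)
    (hV : ∀ t, 0 ≤ t → HasDerivWithinAt V (V' t) (Ici 0) t) (hV0 : ∀ t, 0 ≤ V t)
    (hle : ∀ t, 0 ≤ t →
      V' t ≤ -γ * V t + C₁ * Real.exp (-β * t) * V t + C₂ * Real.exp (-β * t))
    {t : ℝ} (ht : 0 ≤ t) :
    V t ≤ Real.exp (C₁ / β) * (V 0 + C₂ / (β - l)) * Real.exp (-l * t) := by
  have hlin : ∀ r s : ℝ, HasDerivAt (fun s => Real.exp (r * s)) (r * Real.exp (r * s)) s :=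
    fun r s => by
      have h := ((hasDerivAt_id s).const_mul r).exp
      refine h.congr_deriv ?_
      simp only [id, mul_one]
      ring
  -- Integrating factor that absorbs the `C₁` term, with `e^{ls} ≤ G s ≤ e^{ls + C₁/β}` for `s ≥ 0`.
  -- Adding the tail integral of a bound on the `C₂` forcing makes `G V` antitone.
  let G : ℝ → ℝ := fun s => Real.exp (l * s + C₁ / β * Real.exp (-β * s))
  have hG : ∀ s, HasDerivAt G (G s * (l - C₁ * Real.exp (-β * s))) s := fun s => by
    have h := (((hasDerivAt_id s).const_mul l).add ((hlin (-β) s).const_mul (C₁ / β))).exp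
    refine h.congr_deriv ?_
    simp only [G, id, mul_one, Pi.add_apply]
    congr 1
    field_simp
    ring
  have hbl : 0 < β - l := by linarith
  set C₃ := C₂ * Real.exp (C₁ / β) with hC₃
  have hH : ∀ s, 0 ≤ s → HasDerivWithinAt
      (fun s => G s * V s + C₃ / (β - l) * Real.exp (-(β - l) * s))
      (G s * (l - C₁ * Real.exp (-β * s)) * V s + G s * V' s +
        C₃ / (β - l) * (-(β - l) * Real.exp (-(β - l) * s))) (Ici 0) s := fun s hs =>
    ((hG s).hasDerivWithinAt.mul (hV s hs)).add
      ((hlin (-(β - l)) s).const_mul (C₃ / (β - l))).hasDerivWithinAt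
  have hanti : AntitoneOn (fun s => G s * V s + C₃ / (β - l) * Real.exp (-(β - l) * s))
      (Ici 0) := by
    refine antitoneOn_of_hasDerivWithinAt_nonpos (convex_Ici 0)
      (fun s hs => (hH s hs).continuousWithinAt)
      (fun s hs => (hH s (interior_subset hs)).mono interior_subset) fun s hs => ?_
    have hs0 : 0 ≤ s := by simpa using interior_subset hs
    have hGpos : 0 < G s := Real.exp_pos _
    have h1 : C₃ / (β - l) * (-(β - l) * Real.exp (-(β - l) * s)) =
        -(C₃ * Real.exp (-(β - l) * s)) := by field_simp
    have h2 : G s * (C₂ * Real.exp (-β * s)) ≤ C₃ * Real.exp (-(β - l) * s) := by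
      have h3 : G s ≤ Real.exp (l * s + C₁ / β) := by
        refine Real.exp_le_exp.2 ?_
        have : Real.exp (-β * s) ≤ 1 := Real.exp_le_one_iff.2 (by nlinarith)
        have h4 : 0 ≤ C₁ / β := by positivity
        nlinarith
      calc G s * (C₂ * Real.exp (-β * s)) ≤
            Real.exp (l * s + C₁ / β) * (C₂ * Real.exp (-β * s)) := by gcongr
        _ = C₃ * Real.exp (-(β - l) * s) := by
            rw [show -(β - l) * s = l * s + -β * s by ring, Real.exp_add, Real.exp_add, hC₃]
            ring
    have h5 := mul_le_mul_of_nonneg_left (hle s hs0) hGpos.le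
    have h6 : 0 ≤ G s * ((γ - l) * V s) :=
      mul_nonneg hGpos.le (mul_nonneg (by linarith) (hV0 s))
    rw [h1]
    nlinarith
  have h := hanti (mem_Ici.2 le_rfl) (mem_Ici.2 ht) ht
  have hGt : Real.exp (l * t) ≤ G t :=
    Real.exp_le_exp.2 (le_add_of_nonneg_right (by positivity))
  have hG0 : G 0 = Real.exp (C₁ / β) := by simp [G]
  simp only [hG0, mul_zero, Real.exp_zero, mul_one] at h
  have h7 : 0 ≤ C₃ / (β - l) * Real.exp (-(β - l) * t) := by positivity
  have h8 : Real.exp (l * t) * V t ≤ Real.exp (C₁ / β) * (V 0 + C₂ / (β - l)) := by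
    have h9 := mul_le_mul_of_nonneg_right hGt (hV0 t)
    have h10 : Real.exp (C₁ / β) * (V 0 + C₂ / (β - l)) =
        Real.exp (C₁ / β) * V 0 + C₃ / (β - l) := by rw [hC₃]; ring
    linarith
  calc V t = Real.exp (l * t) * V t * Real.exp (-l * t) := by
        rw [mul_right_comm, ← Real.exp_add]; simp
    _ ≤ _ := by gcongr

lemma contDiff_companion_pow {n : ℕ} (l : ℕ) (i j : Fin n) :
    ContDiff ℝ 1 fun p : (Fin (2 * n) → ℝ) × (Fin n → ℝ) => (companion p.2 ^ l) i j := by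
  induction l generalizing i j with
  | zero => simp only [pow_zero]; exact contDiff_const
  | succ l ih =>
    simp only [pow_succ, mul_apply]
    refine ContDiff.sum fun k _ => (ih i k).mul ?_
    simp only [companion, of_apply]
    split_ifs <;> fun_prop

lemma contDiff_outputMap {n : ℕ} (mc : Fin (2 * n) → ℝ) :
    ContDiff ℝ 1 fun p : (Fin (2 * n) → ℝ) × (Fin n → ℝ) => outputMap mc p.1 p.2 := by
  simp only [outputMap, dotProduct, mulVec, Xi, Matrix.add_apply, Matrix.sum_apply, Matrix.smul_apply,
    firstHalf]
  refine ContDiff.sum fun i _ => contDiff_const.mul (ContDiff.sum fun j _ => ContDiff.mul ?_ ?_)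
  · exact (contDiff_companion_pow _ i j).add
      (ContDiff.sum fun l _ => (contDiff_companion_pow _ i j).const_smul (mc l))
  · fun_prop

/-- The output map is Lipschitz on bounded sets. -/
lemma exists_outputMap_lipschitz {n : ℕ} (mc : Fin (2 * n) → ℝ) (ρ : ℝ) :
    ∃ L : ℝ, 0 ≤ L ∧ ∀ (η η' : Fin (2 * n) → ℝ) (α α' : Fin n → ℝ), ‖η‖ ≤ ρ → ‖η'‖ ≤ ρ →
      ‖α‖ ≤ ρ → ‖α'‖ ≤ ρ →
      |outputMap mc η α - outputMap mc η' α'| ≤ L * (‖η - η'‖ + ‖α - α'‖) := by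
  obtain ⟨K, hK⟩ := ((contDiff_outputMap mc).locallyLipschitz.locallyLipschitzOn
    (s := Metric.closedBall 0 ρ)).exists_lipschitzOnWith_of_compact (isCompact_closedBall _ _)
  refine ⟨K, K.2, fun η η' α α' h1 h2 h3 h4 => ?_⟩
  have h := hK.dist_le_mul (η, α) (by simp [Prod.norm_def, h1, h3]) (η', α')
    (by simp [Prod.norm_def, h2, h4])
  rw [Real.dist_eq, dist_eq_norm, Prod.mk_sub_mk, Prod.norm_mk] at h
  refine h.trans ?_
  have := K.2
  gcongr
  exact max_le (le_add_of_nonneg_right (norm_nonneg _)) (le_add_of_nonneg_left (norm_nonneg _))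

/-! ### Comparison of norms, filter convergence and the Lyapunov estimate. -/

lemma norm_ofReal_vec {N : ℕ} (x : Fin N → ℝ) : ‖fun i => (x i : ℂ)‖ = ‖x‖ := by
  simp [Pi.norm_def]

lemma norm_re_vec_le {N : ℕ} (z : Fin N → ℂ) : ‖fun i => (z i).re‖ ≤ ‖z‖ :=
  (pi_norm_le_iff_of_nonneg (norm_nonneg z)).2 fun i =>
    (Complex.abs_re_le_norm (z i)).trans (norm_le_pi_norm z i)

lemma euclNorm_sq {N : ℕ} (x : Fin N → ℝ) : euclNorm x ^ 2 = x ⬝ᵥ x := by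
  rw [euclNorm, EuclideanSpace.norm_sq_eq]
  simp [dotProduct, sq]

lemma euclNorm_nonneg {N : ℕ} (x : Fin N → ℝ) : 0 ≤ euclNorm x := norm_nonneg _

lemma norm_sq_le_dotProduct_self {N : ℕ} (x : Fin N → ℝ) : ‖x‖ ^ 2 ≤ x ⬝ᵥ x := by
  have h0 : 0 ≤ x ⬝ᵥ x := Finset.sum_nonneg fun i _ => mul_self_nonneg _
  refine Real.le_sqrt (norm_nonneg _) h0 |>.1 ((pi_norm_le_iff_of_nonneg (Real.sqrt_nonneg _)).2
    fun i => Real.le_sqrt (norm_nonneg _) h0 |>.2 ?_)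
  rw [Real.norm_eq_abs, sq_abs, sq]
  exact Finset.single_le_sum (f := fun i => x i * x i) (fun i _ => mul_self_nonneg _)
    (Finset.mem_univ i)

lemma dotProduct_self_le {N : ℕ} (x : Fin N → ℝ) : x ⬝ᵥ x ≤ N * ‖x‖ ^ 2 := by
  calc x ⬝ᵥ x ≤ ∑ _i : Fin N, ‖x‖ ^ 2 := Finset.sum_le_sum fun i _ => by
        rw [← sq, ← sq_abs (x i)]
        gcongr
        exact norm_le_pi_norm x i
    _ = N * ‖x‖ ^ 2 := by simp

lemma norm_le_euclNorm {N : ℕ} (x : Fin N → ℝ) : ‖x‖ ≤ euclNorm x := by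
  refine le_of_sq_le_sq ?_ (euclNorm_nonneg x)
  rw [euclNorm_sq]
  exact norm_sq_le_dotProduct_self x

lemma norm_complexHankel_mulVec_le {n : ℕ} (θ : Fin (2 * n) → ℂ) (x : Fin n → ℂ) :
    ‖complexHankel θ *ᵥ x‖ ≤ n * ‖θ‖ * ‖x‖ := by
  refine (pi_norm_le_iff_of_nonneg (by positivity)).2 fun i => ?_
  simp only [mulVec, dotProduct, complexHankel, of_apply]
  calc _ ≤ ∑ _j : Fin n, ‖θ‖ * ‖x‖ := by
        refine (norm_sum_le _ _).trans (Finset.sum_le_sum fun j _ => ?_)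
        rw [norm_mul]
        gcongr <;> exact norm_le_pi_norm _ _
    _ = _ := by simp [mul_assoc]

lemma ofReal_Hankel_mulVec {n : ℕ} (η : Fin (2 * n) → ℝ) (x : Fin n → ℝ) :
    (fun i => ((Hankel η *ᵥ x) i : ℂ)) =
      complexHankel (fun i => (η i : ℂ)) *ᵥ fun i => (x i : ℂ) :=
  funext (RingHom.map_mulVec Complex.ofRealHom (Hankel η) x)

lemma complexHankel_add {n : ℕ} (θ θ' : Fin (2 * n) → ℂ) :
    complexHankel (θ + θ') = complexHankel θ + complexHankel θ' := rfl

/-- The filter state approaches the steady state exponentially. -/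
lemma exists_filter_decay {n : ℕ} {mc : Fin (2 * n) → ℝ} (hM : IsHurwitz (companion mc))
    {μ γ : Fin n → ℂ} {y : ℝ → ℝ}
    (hy : ∀ t : ℝ, 0 ≤ t →
      (y t : ℂ) = ∑ k, γ k * charEval mc (μ k) * Complex.exp (μ k * t)) :
    ∃ β C : ℝ, 0 < β ∧ 0 ≤ C ∧ ∀ η : ℝ → Fin (2 * n) → ℝ,
      (∀ t, 0 ≤ t → HasDerivWithinAt η (companion mc *ᵥ η t + y t • inputVec n) (Ici 0) t) →
      ∀ t, 0 ≤ t → ‖(fun i => (η t i : ℂ)) - expJet (2 * n) μ γ t‖ ≤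
        C * ‖(fun i => (η 0 i : ℂ)) - expJet (2 * n) μ γ 0‖ * Real.exp (-β * t) := by
  obtain ⟨β, C, hβ, hC, h⟩ := exists_decay_of_spectrum _ hM
  refine ⟨β, C, hβ, hC, fun η hη => h _ fun t ht => ?_⟩
  have h1 : HasDerivWithinAt (fun t i => (η t i : ℂ))
      (fun i => ((companion mc *ᵥ η t + y t • inputVec n) i : ℂ)) (Ici 0) t :=
    hasDerivWithinAt_pi.2 fun i => (hasDerivWithinAt_pi.1 (hη t ht) i).ofReal_comp
  refine (h1.sub (hasDerivAt_expJet μ γ t).hasDerivWithinAt).congr_deriv ?_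
  rw [mulVec_sub, companion_map_mulVec_expJet]
  have h2 : (fun i => ((companion mc *ᵥ η t) i : ℂ)) =
      (companion mc).map Complex.ofReal *ᵥ fun i => (η t i : ℂ) :=
    funext (RingHom.map_mulVec Complex.ofRealHom (companion mc) (η t))
  rw [← h2]
  funext i
  simp only [Pi.sub_apply, Pi.add_apply, Pi.smul_apply, inputVec, smul_eq_mul, Complex.ofReal_add,
    Complex.ofReal_mul]
  split_ifs
  · rw [hy t ht]; push_cast; ring
  · push_cast; ring

lemma hasDerivWithinAt_dotProduct_self {n : ℕ} {x : ℝ → Fin n → ℝ} {x' : Fin n → ℝ} {s : Set ℝ}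
    {t : ℝ} (h : HasDerivWithinAt x x' s t) :
    HasDerivWithinAt (fun t => x t ⬝ᵥ x t) (2 * (x t ⬝ᵥ x')) s t := by
  rw [hasDerivWithinAt_pi] at h
  simp only [dotProduct, Finset.mul_sum]
  exact HasDerivWithinAt.fun_sum fun i _ => ((h i).mul (h i)).congr_deriv (by ring)

/-- The right side minus the left is `(q + ε) ⬝ᵥ (q + ε)`. -/
lemma neg_dotProduct_add_le {n : ℕ} (q ε : Fin n → ℝ) :
    -(2 * (q ⬝ᵥ (q + ε))) ≤ -(q ⬝ᵥ q) + ε ⬝ᵥ ε := by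
  simp only [dotProduct, Finset.mul_sum, ← Finset.sum_neg_distrib, ← Finset.sum_add_distrib]
  refine Finset.sum_le_sum fun i _ => ?_
  simp only [Pi.add_apply]
  nlinarith [sq_nonneg (q i + ε i)]

/-- The Lyapunov inequality for the estimation error `x = â - a`. -/
lemma lyapunov_le {n : ℕ} (hn : 0 < n) {a : Fin n → ℝ} {k₁ : ℝ} (hk₁ : 0 < k₁)
    {η : Fin (2 * n) → ℝ} {z : Fin (2 * n) → ℂ} {σ e : ℝ} (hσ : 0 < σ)
    (hz : ∀ x, σ * ‖x‖ ≤ ‖complexHankel z *ᵥ x‖)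
    (hza : complexHankel z *ᵥ (fun i => (a i : ℂ)) + complexSecondHalf z = 0)
    (he : ‖(fun i => (η i : ℂ)) - z‖ ≤ e) (α : Fin n → ℝ) :
    2 * ((α - a) ⬝ᵥ -(k₁ • (Hankel η)ᵀ *ᵥ (Hankel η *ᵥ α + secondHalf η))) ≤
      -(k₁ * σ ^ 2 / (2 * n)) * ((α - a) ⬝ᵥ (α - a)) +
        k₁ * (n * e) ^ 2 * ((α - a) ⬝ᵥ (α - a)) + k₁ * n * ((n * ‖a‖ + 1) * e) ^ 2 := by
  set x := α - a with hx
  set E : Fin (2 * n) → ℂ := (fun i => (η i : ℂ)) - z with hE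
  set q := Hankel η *ᵥ x with hq
  set ε := Hankel η *ᵥ a + secondHalf η with hε
  have he0 : 0 ≤ e := (norm_nonneg _).trans he
  have hn' : (0 : ℝ) < n := Nat.cast_pos.2 hn
  have hηE : (fun i => (η i : ℂ)) = z + E := by rw [hE]; abel
  -- Here `ε` is the residual at the true parameter; it vanishes on the steady state, so it is
  -- linear in the filter error `E`.
  have hsum : Hankel η *ᵥ α + secondHalf η = q + ε := by
    rw [hq, hε, hx, mulVec_sub]; abel
  have h1 : 2 * (x ⬝ᵥ -(k₁ • (Hankel η)ᵀ *ᵥ (Hankel η *ᵥ α + secondHalf η))) =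
      k₁ * -(2 * (q ⬝ᵥ (q + ε))) := by
    rw [hsum, dotProduct_neg, dotProduct_smul, dotProduct_mulVec, vecMul_transpose, smul_eq_mul]
    ring
  have hqn : σ * ‖x‖ ≤ ‖q‖ + n * e * ‖x‖ := by
    have h2 := hz fun i => (x i : ℂ)
    have h3 := ofReal_Hankel_mulVec η x
    rw [hηE, complexHankel_add, add_mulVec] at h3
    rw [norm_ofReal_vec, ← sub_eq_iff_eq_add.2 h3] at h2
    refine h2.trans ((norm_sub_le _ _).trans ?_)
    rw [norm_ofReal_vec]
    gcongr
    refine (norm_complexHankel_mulVec_le _ _).trans ?_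
    rw [norm_ofReal_vec]
    gcongr
  have hεn : ‖ε‖ ≤ (n * ‖a‖ + 1) * e := by
    have h3 : (fun i => (ε i : ℂ)) =
        complexHankel E *ᵥ (fun i => (a i : ℂ)) + complexSecondHalf E := by
      have h4 : (fun i => (ε i : ℂ)) = (fun i => ((Hankel η *ᵥ a) i : ℂ)) +
          complexSecondHalf (fun i => (η i : ℂ)) := by
        funext i; simp [hε, secondHalf, complexSecondHalf]
      have h5 : complexSecondHalf (z + E) = complexSecondHalf z + complexSecondHalf E := rfl
      rw [h4, ofReal_Hankel_mulVec, hηE, complexHankel_add, add_mulVec, h5, add_add_add_comm, hza,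
        zero_add]
    have h6 : ‖complexSecondHalf E‖ ≤ ‖E‖ :=
      (pi_norm_le_iff_of_nonneg (norm_nonneg _)).2 fun i => norm_le_pi_norm E _
    rw [← norm_ofReal_vec, h3]
    refine (norm_add_le _ _).trans ((add_le_add (norm_complexHankel_mulVec_le _ _) h6).trans ?_)
    rw [norm_ofReal_vec]
    calc n * ‖E‖ * ‖a‖ + ‖E‖ = (n * ‖a‖ + 1) * ‖E‖ := by ring
      _ ≤ _ := by gcongr
  -- The factor `2` comes from squaring a sum, the `n` from passing between sup and Euclidean norms.
  have hqq : σ ^ 2 / (2 * n) * (x ⬝ᵥ x) ≤ q ⬝ᵥ q + (n * e) ^ 2 * (x ⬝ᵥ x) := by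
    have h2 : (σ * ‖x‖) ^ 2 ≤ 2 * ‖q‖ ^ 2 + 2 * (n * e * ‖x‖) ^ 2 := by
      have h3 : (σ * ‖x‖) ^ 2 ≤ (‖q‖ + n * e * ‖x‖) ^ 2 := by gcongr
      nlinarith [sq_nonneg (‖q‖ - n * e * ‖x‖)]
    have h4 := norm_sq_le_dotProduct_self q
    have h5 : (n * e) ^ 2 * ‖x‖ ^ 2 ≤ (n * e) ^ 2 * (x ⬝ᵥ x) := by
      gcongr; exact norm_sq_le_dotProduct_self x
    have h6 : σ ^ 2 / (2 * n) * (x ⬝ᵥ x) ≤ σ ^ 2 / (2 * n) * (n * ‖x‖ ^ 2) := by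
      gcongr; exact dotProduct_self_le x
    have h7 : σ ^ 2 / (2 * n) * (n * ‖x‖ ^ 2) = (σ * ‖x‖) ^ 2 / 2 := by field_simp
    nlinarith
  have hεε : ε ⬝ᵥ ε ≤ n * ((n * ‖a‖ + 1) * e) ^ 2 := (dotProduct_self_le ε).trans (by gcongr)
  rw [h1]
  calc k₁ * -(2 * (q ⬝ᵥ (q + ε))) ≤ k₁ * (-(q ⬝ᵥ q) + ε ⬝ᵥ ε) := by
        gcongr; exact neg_dotProduct_add_le q ε
    _ ≤ k₁ * (-(σ ^ 2 / (2 * n) * (x ⬝ᵥ x)) + (n * e) ^ 2 * (x ⬝ᵥ x) +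
          n * ((n * ‖a‖ + 1) * e) ^ 2) := by
        gcongr
        linarith
    _ = _ := by ring

/-- The filter state converges to the steady state and the parameter estimate converges to the
true parameter, exponentially and uniformly over bounded sets of initial values. -/
lemma exists_observer_decay {n : ℕ} (hn : 0 < n) {a : Fin n → ℝ} {mc : Fin (2 * n) → ℝ}
    (hM : IsHurwitz (companion mc)) {k₁ : ℝ} (hk₁ : 0 < k₁) {μ γ : Fin n → ℂ}
    (hμ : Function.Injective μ) (hre : ∀ k, (μ k).re = 0) (hγ : ∀ k, γ k ≠ 0)
    (hμa : ∀ k, charEval a (μ k) = 0) {y : ℝ → ℝ}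
    (hy : ∀ t : ℝ, 0 ≤ t →
      (y t : ℂ) = ∑ k, γ k * charEval mc (μ k) * Complex.exp (μ k * t)) :
    ∃ l : ℝ, 0 < l ∧ ∀ R : ℝ, 0 ≤ R → ∃ C : ℝ, 0 ≤ C ∧
      ∀ (η : ℝ → Fin (2 * n) → ℝ) (ah : ℝ → Fin n → ℝ), IsObserverSolution mc k₁ y η ah →
        euclNorm (η 0) ≤ R → euclNorm (ah 0) ≤ R → ∀ t : ℝ, 0 ≤ t →
          euclNorm (ah t - a) ≤ C * Real.exp (-l * t) ∧
          ‖η t - fun i => (expJet (2 * n) μ γ t i).re‖ ≤ C * Real.exp (-l * t) := by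
  obtain ⟨β, C₀, hβ, hC₀, hfilter⟩ := exists_filter_decay hM hy
  obtain ⟨B, hB⟩ := exists_norm_expJet_le (N := 2 * n) (γ := γ) hre
  have hB0 : 0 ≤ B := (norm_nonneg _).trans (hB 0)
  obtain ⟨σ, hσ, hlow⟩ := exists_le_norm_complexHankel_expJet hμ hre hγ
  have hn' : (0 : ℝ) < n := Nat.cast_pos.2 hn
  set g := k₁ * σ ^ 2 / (2 * n) with hg
  have hg0 : 0 < g := by positivity
  -- Chosen before `R`, so the rate is uniform. The squared error decays at rate `2 * l`, against
  -- perturbations of rate `2 * β`; this needs `2 * l ≤ g` and `2 * l < 2 * β`.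
  set l := min (g / 2) (β / 2) with hl
  have hl0 : 0 < l := lt_min (by positivity) (by positivity)
  have hlg : 2 * l ≤ g := by linarith [min_le_left (g / 2) (β / 2)]
  have hlβ : 2 * l ≤ β := by linarith [min_le_right (g / 2) (β / 2)]
  refine ⟨l, hl0, fun R hR => ?_⟩
  set D := C₀ * (R + B) with hD
  have hD0 : 0 ≤ D := by positivity
  set C₁ := k₁ * (n * D) ^ 2 with hC₁
  set C₂ := k₁ * n * ((n * ‖a‖ + 1) * D) ^ 2 with hC₂
  have hβl : 0 < 2 * β - 2 * l := by linarith
  set Q := Real.exp (C₁ / (2 * β)) * (n * (R + ‖a‖) ^ 2 + C₂ / (2 * β - 2 * l)) with hQ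
  have hQ0 : 0 ≤ Q := by positivity
  refine ⟨Real.sqrt Q + D, by positivity, fun η ah hobs hη0 hah0 t ht => ?_⟩
  have hE : ∀ t, 0 ≤ t →
      ‖(fun i => (η t i : ℂ)) - expJet (2 * n) μ γ t‖ ≤ D * Real.exp (-β * t) := fun t ht => by
    refine (hfilter η (fun t ht => (hobs t ht).1) t ht).trans ?_
    rw [hD]
    gcongr
    refine (norm_sub_le _ _).trans (add_le_add ?_ (hB 0))
    rw [norm_ofReal_vec]
    exact (norm_le_euclNorm _).trans hη0
  have hV := decay_of_deriv_le (V := fun t => (ah t - a) ⬝ᵥ (ah t - a)) (γ := g) (β := 2 * β)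
    (C₁ := C₁) (C₂ := C₂) (l := 2 * l) (by positivity) (by positivity) (by positivity) hlg
    (by linarith) (fun t ht => hasDerivWithinAt_dotProduct_self ((hobs t ht).2.sub_const a))
    (fun t => Finset.sum_nonneg fun i _ => mul_self_nonneg _)
    (fun t ht => by
      have h := lyapunov_le hn hk₁ hσ (hlow t) (complexHankel_expJet_mulVec_add hμa γ t)
        (hE t ht) (ah t)
      refine h.trans (le_of_eq ?_)
      have h2 : Real.exp (-(2 * β) * t) = Real.exp (-β * t) ^ 2 := by
        rw [sq, ← Real.exp_add]; congr 1; ring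
      rw [h2, hC₁, hC₂, hg]
      ring) ht
  have hl_exp : Real.exp (-β * t) ≤ Real.exp (-l * t) :=
    Real.exp_le_exp.2 (by nlinarith)
  refine ⟨?_, ?_⟩
  · have h0 : (ah 0 - a) ⬝ᵥ (ah 0 - a) ≤ n * (R + ‖a‖) ^ 2 := by
      refine (dotProduct_self_le _).trans ?_
      gcongr
      exact (norm_sub_le _ _).trans (add_le_add_left ((norm_le_euclNorm _).trans hah0) _)
    have h1 : euclNorm (ah t - a) ^ 2 ≤ (Real.sqrt Q * Real.exp (-l * t)) ^ 2 := by
      rw [euclNorm_sq, mul_pow, Real.sq_sqrt hQ0]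
      have h2 : Real.exp (-l * t) ^ 2 = Real.exp (-(2 * l) * t) := by
        rw [sq, ← Real.exp_add]; congr 1; ring
      rw [h2]
      refine hV.trans ?_
      rw [hQ]
      gcongr
    refine (le_of_sq_le_sq h1 (by positivity)).trans ?_
    gcongr
    linarith
  · have h1 : ‖η t - fun i => (expJet (2 * n) μ γ t i).re‖ ≤ D * Real.exp (-β * t) := by
      refine le_trans ?_ (hE t ht)
      refine le_of_eq_of_le ?_ (norm_re_vec_le _)
      congr 1
    refine h1.trans ?_
    have := Real.sqrt_nonneg Q
    gcongr
    linarith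

end SinusoidObserver

/-! ### Assembly of the main theorem. -/

open SinusoidObserver
theorem mainTheorem2 (m n : ℕ) (hn : 0 < n)
    -- the exosystem `v' = Φ(a) v`, `y₀ = Γ v`
    (a : Fin n → ℝ)
    (ha : SinusoidObserver.HasDistinctImaginaryEigenvalues (SinusoidObserver.companion a))
    (v : ℝ → Fin n → ℝ) (hv : SinusoidObserver.IsExosystemSolution a v)
    (y₀ : ℝ → ℝ) (hyv : ∀ t : ℝ, 0 ≤ t → y₀ t = SinusoidObserver.Gam n ⬝ᵥ v t)
    -- `y₀` is a bias plus `m` sinusoids; its frequencies are nonzero and distinct (up to sign)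
    (d₀ : ℝ) (d ω φ : Fin m → ℝ) (hd : ∀ k, d k ≠ 0) (hω : ∀ k, ω k ≠ 0)
    (hωdist : Function.Injective fun k => |ω k|)
    (hy : ∀ t : ℝ, 0 ≤ t → y₀ t = d₀ + ∑ k, d k * Real.sin (ω k * t + φ k))
    (hdim : (d₀ = 0 ∧ n = 2 * m) ∨ (d₀ ≠ 0 ∧ n = 2 * m + 1))
    -- the observer parameters
    (mc : Fin (2 * n) → ℝ)
    (hM : SinusoidObserver.IsHurwitz (SinusoidObserver.companion mc))
    (k₁ : ℝ) (hk₁ : 0 < k₁) :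
    (∀ (η₀ : Fin (2 * n) → ℝ) (ah₀ : Fin n → ℝ),
      ∃ (η : ℝ → Fin (2 * n) → ℝ) (ah : ℝ → Fin n → ℝ),
        SinusoidObserver.IsObserverSolution mc k₁ y₀ η ah ∧ η 0 = η₀ ∧ ah 0 = ah₀) ∧
    ∃ lam : ℝ, 0 < lam ∧ ∀ R : ℝ, ∃ C : ℝ,
      ∀ (η : ℝ → Fin (2 * n) → ℝ) (ah : ℝ → Fin n → ℝ),
        SinusoidObserver.IsObserverSolution mc k₁ y₀ η ah →
        SinusoidObserver.euclNorm (η 0) ≤ R → SinusoidObserver.euclNorm (ah 0) ≤ R →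
        ∀ t : ℝ, 0 ≤ t →
          SinusoidObserver.euclNorm (ah t - a) ≤ C * Real.exp (-lam * t) ∧
          |SinusoidObserver.outputMap mc (η t) (ah t) - y₀ t| ≤ C * Real.exp (-lam * t) := by
  obtain ⟨μ, c, hμ, hre, hc, hexp⟩ := exists_expSum_of_multitone φ hd hω hωdist hdim
  have hμa : ∀ k, charEval a (μ k) = 0 := charEval_eq_zero_of_exosystem hn hv hμ hc
    fun t ht => by rw [← hyv t ht, hy t ht, hexp]
  -- A zero would put an imaginary number in the spectrum of the Hurwitz matrix.
  have hμM : ∀ k, charEval mc (μ k) ≠ 0 := fun k h0 => by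
    have h := hM _ (mem_spectrum_companion (by omega) mc h0)
    rw [hre k] at h
    exact lt_irrefl _ h
  let γ : Fin n → ℂ := fun k => c k / charEval mc (μ k)
  have hyγ : ∀ t : ℝ, 0 ≤ t →
      (y₀ t : ℂ) = ∑ k, γ k * charEval mc (μ k) * Complex.exp (μ k * t) := fun t ht => by
    rw [hy t ht, hexp]
    exact Finset.sum_congr rfl fun k _ => by rw [div_mul_cancel₀ _ (hμM k)]
  refine ⟨fun η₀ ah₀ => exists_observer_solution mc k₁ ?_ η₀ ah₀, ?_⟩
  · refine ContinuousOn.congr (f := fun t => d₀ + ∑ k, d k * Real.sin (ω k * t + φ k)) ?_ hy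
    fun_prop
  obtain ⟨l, hl, hdecay⟩ := exists_observer_decay hn hM hk₁ hμ hre
    (fun k => div_ne_zero (hc k) (hμM k)) hμa hyγ
  obtain ⟨B, hB⟩ := exists_norm_expJet_le (N := 2 * n) (γ := γ) hre
  have hB0 : 0 ≤ B := (norm_nonneg _).trans (hB 0)
  refine ⟨l, hl, fun R => ?_⟩
  obtain ⟨C, hC, hdecay⟩ := hdecay |R| (abs_nonneg R)
  -- This radius contains `η`, its steady state, `â` and `a` at all times `t ≥ 0`.
  obtain ⟨L, hL, hlip⟩ := exists_outputMap_lipschitz mc (B + C + ‖a‖)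
  refine ⟨C + L * (C + C), fun η ah hobs hη0 hah0 t ht => ?_⟩
  obtain ⟨h1, h2⟩ := hdecay η ah hobs (hη0.trans (le_abs_self R)) (hah0.trans (le_abs_self R)) t ht
  have h1' := (norm_le_euclNorm (ah t - a)).trans h1
  have hle : C * Real.exp (-l * t) ≤ C :=
    mul_le_of_le_one_right hC (Real.exp_le_one_iff.2 (by nlinarith))
  have hz : ‖fun i => (expJet (2 * n) μ γ t i).re‖ ≤ B := (norm_re_vec_le _).trans (hB t)
  have ha0 := norm_nonneg a
  have hout := hlip (η t) (fun i => (expJet (2 * n) μ γ t i).re) (ah t) a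
    (by linarith [norm_le_norm_add_norm_sub' (η t) fun i => (expJet (2 * n) μ γ t i).re])
    (by linarith) (by linarith [norm_le_norm_add_norm_sub' (ah t) a]) (by linarith)
  rw [outputMap_re_expJet hn mc hμa, ← hyγ t ht, Complex.ofReal_re] at hout
  have hexp0 := Real.exp_pos (-l * t)
  refine ⟨h1.trans ?_, hout.trans ?_⟩
  · gcongr
    exact le_add_of_nonneg_right (by positivity)
  · calc L * (_ + _) ≤ L * (C * Real.exp (-l * t) + C * Real.exp (-l * t)) := by gcongr
      _ = L * (C + C) * Real.exp (-l * t) := by ring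
      _ ≤ _ := by
        gcongr
        exact le_add_of_nonneg_left hC
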